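/- Let $M_n$ (the Motzkin number) be the number of lattice paths from $(0,0)$ to $(n,0)$ with steps $(1,1)$, $(1,0)$, $(1,-1)$ that never go below the $x$-axis, and let $T_n$ (the central trinomial coefficient) be the number of such paths without the restriction of staying on or above the $x$-axis. Let $p$ be a prime. The density of a value $x\in\mathbb F_p$ in a sequence $(u_n)_{n\ge 0}$ over $\mathbb F_p$ is $\lim_{N\to\infty}\frac1N\left|\{0\le n<N : u_n=x\}\right|$. All congruences are modulo $p$, and $n,m$ range over non-negative integers. 1. If $p\mid T_n$ for some $n<p$, then the density of $0$ in $M_n \bmod p$ exists and equals $1$. 2. If $p>2$ and $p\nmid T_n$ for all $n<p$, then the density of $0$ in $M_n\bmod p$ exists and equals $$\frac{\left|\{n<p-2 : M_n\equiv 0\}\right|}{p}+\frac{2\left|\{m<p-1 : T_m\equiv T_{p-1}T_{m+1}\}\right|}{(p-1)(p+1)}+\frac{2\left|\{m<p-1 : T_m\equiv T_{m+1}\}\right|}{(p-1)p(p+1)}.$$ Write $D_0$ for the density of $0$ in $M_n \bmod p$ whenever it exists (in particular for all $p>2$, by 1 and 2). 3. Suppose that the following conjecture holds for $p$: if $p\nmid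 T_n$ for all $n<p$, then the residues of $T_0,\dots,T_{p-1}$ generate the multiplicative group $\mathbb F_p^\times$. Then every nonzero $x\in\mathbb F_p$ has density $\frac{1-D_0}{p-1}$ in $M_n\bmod p$. 4. If $p>2$, then $D_0\ge\frac{2}{p(p-1)}$. -/

import Mathlib

open Filter Topology

/-- A lattice path from the origin with `n` steps UP `(1, 1)`, LEVEL `(1, 0)`, DOWN `(1, -1)`,
encoded by the sequence of its vertical increments. -/
def latticePaths (n : ℕ) : Finset (Fin n → ℤ) :=
  Fintype.piFinset fun _ => {-1, 0, 1}

/-- The central trinomial coefficient `T_n`: the number of lattice paths from `(0, 0)` to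
`(n, 0)`. -/
def centralTrinomial (n : ℕ) : ℕ :=
  ((latticePaths n).filter fun s => ∑ i, s i = 0).card

/-- The Motzkin number `M_n`: the number of lattice paths from `(0, 0)` to `(n, 0)` that never go
below the horizontal axis (the height after each step is nonnegative). -/
def motzkin (n : ℕ) : ℕ :=
  ((latticePaths n).filter fun s =>
    ∑ i, s i = 0 ∧ ∀ j : Fin n, 0 ≤ ∑ i ∈ Finset.Iic j, s i).card

/-- `S ⊆ ℕ` has asymptotic density `d` (the limit exists and equals `d`). -/
def HasAsympDensity (S : Set ℕ) (d : ℝ) : Prop :=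
  Tendsto (fun N : ℕ => ((S ∩ Set.Iio N).ncard : ℝ) / (N : ℝ)) atTop (𝓝 d)

/-- The value `x` has density `d` in the sequence `u` over `ZMod p`. -/
def ValueHasDensity {p : ℕ} (u : ℕ → ZMod p) (x : ZMod p) (d : ℝ) : Prop :=
  HasAsympDensity {n | u n = x} d

/-- The conjecture, at the prime `p`, on central trinomial coefficients: if `p` divides none of
`T_0, …, T_{p-1}`, then their residues generate the multiplicative group of `ZMod p`. -/
def TrinomialGenerationConjectureAt (p : ℕ) : Prop :=
  (∀ n < p, ¬ p ∣ centralTrinomial n) →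
    Subgroup.closure {g : (ZMod p)ˣ | ∃ n < p, (g : ZMod p) = (centralTrinomial n : ZMod p)} = ⊤

/-- The explicit expression for the density of `0`, used for primes `p > 2`. -/
noncomputable def motzkinZeroDensity (p : ℕ) : ℝ :=
  (({n ∈ Finset.range (p - 2) | (motzkin n : ZMod p) = 0} : Finset ℕ).card : ℝ) / (p : ℝ)
  + 2 * (({m ∈ Finset.range (p - 1) | (centralTrinomial m : ZMod p)
        = (centralTrinomial (p - 1) : ZMod p) * (centralTrinomial (m + 1) : ZMod p)} :
          Finset ℕ).card : ℝ) / (((p : ℝ) - 1) * ((p : ℝ) + 1))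
  + 2 * (({m ∈ Finset.range (p - 1) | (centralTrinomial m : ZMod p)
        = (centralTrinomial (m + 1) : ZMod p)} : Finset ℕ).card : ℝ)
      / (((p : ℝ) - 1) * (p : ℝ) * ((p : ℝ) + 1))

/-!
Write `P = x + 1 + x⁻¹`. Then `T_n` is the constant coefficient of `P ^ n`, and by the reflection
principle `M_n` is its constant coefficient minus its coefficient at `x ^ 2`. Modulo `p`, the
Frobenius identity `P ^ q = x ^ q + 1 + x ^ (-q)`, `q = p ^ i`, gives `T_{qn+s} = T_n T_s` for
`s < q` and `M_{qn+s} = T_n M_s` for `s < q - 2`.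

Let `χ` be a Dirichlet character modulo `p`. Summing `χ(T_k)` over the `n`-th block of length `q`
multiplies `χ(T_n)` by `λ ^ i`, where `λ = ∑_{m < p} χ(T_m)`. As `T_0 = 1`, `|λ| < p` as soon as
`χ(T_m) ≠ 1` for some `m < p`; then `χ(T_n)` has mean `0`, and so has `χ(M_n)`, which differs from
it on long blocks by a constant factor and boundedly many terms. For `χ = 1` this says that `0` has
density `1` once `p` divides some `T_m`; for all `χ ≠ 1` together it is equidistribution of `M_n`
over the nonzero residues.

If no `T_n` vanishes modulo `p`, then `M_{pn+s} = 0` iff `M_s = 0` for `s < p - 2`, while for the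
last two residues `s` it means that `T_{n+1} / T_n` is `ε` or `-3ε`, where `ε = T_{p-1} = ±1`.
Appending a base `p` digit `s < p - 1` to `n` replaces the ratio `T_{n+1} / T_n` by
`T_{s+1} / T_s`, and the digit `p - 1` multiplies it by `ε`; this gives a linear system for the
densities of the values of the ratio. The reflection `(-3) ^ n T_{p-1-n} = ε T_n` relates the
counts of the ratios `c` and `-3 / c`.
-/

/-! ### Trinomial coefficients -/

open LaurentPolynomial in
/-- The coefficient of `x ^ k` in `(x + 1 + x⁻¹) ^ n` over the ring `R`. -/
noncomputable def trinomialCoeff (R : Type*) [CommRing R] (n : ℕ) (k : ℤ) : R :=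
  ((T 1 + T 0 + T (-1) : R[T;T⁻¹]) ^ n).coeff k

section Laurent

open LaurentPolynomial

variable {R : Type*}

theorem laurentPolynomial_coeff_mul_T [Semiring R] (f : R[T;T⁻¹]) (a k : ℤ) :
    (f * T a).coeff k = f.coeff (k - a) := by
  rw [T, AddMonoidAlgebra.coeff_mul_single_apply, mul_one, sub_eq_add_neg]

theorem laurentPolynomial_T_sum [CommSemiring R] {ι : Type*} (s : Finset ι) (f : ι → ℤ) :
    (T (∑ i ∈ s, f i) : R[T;T⁻¹]) = ∏ i ∈ s, T (f i) := by
  have h := map_prod (AddMonoidAlgebra.of R ℤ) (fun i => Multiplicative.ofAdd (f i)) s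
  rwa [← ofAdd_sum] at h

theorem laurentPolynomial_charP [CommSemiring R] (p : ℕ) [CharP R p] : CharP R[T;T⁻¹] p :=
  charP_of_injective_algebraMap (R := R)
    (fun a b h => by simpa using congrArg (fun f => f.coeff 0) h) p

end Laurent

namespace trinomialCoeff

open LaurentPolynomial

variable {R : Type*} [CommRing R]

theorem zero_left (k : ℤ) : trinomialCoeff R 0 k = if k = 0 then 1 else 0 := by
  rw [trinomialCoeff, pow_zero, ← T_zero, T_apply]
  simp only [eq_comm]

theorem succ_left (n : ℕ) (k : ℤ) : trinomialCoeff R (n + 1) k =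
    trinomialCoeff R n (k - 1) + trinomialCoeff R n k + trinomialCoeff R n (k + 1) := by
  simp only [trinomialCoeff, pow_succ, mul_add, AddMonoidAlgebra.coeff_add, Finsupp.add_apply,
    laurentPolynomial_coeff_mul_T, sub_zero, sub_neg_eq_add]

theorem neg_right (n : ℕ) (k : ℤ) : trinomialCoeff R n (-k) = trinomialCoeff R n k := by
  rw [trinomialCoeff, trinomialCoeff, ← invert_apply, map_pow, map_add, map_add, invert_T,
    invert_T, invert_T, neg_neg, neg_zero]
  congr 2
  ring

theorem eq_zero_of_lt_abs {n : ℕ} {k : ℤ} (h : (n : ℤ) < |k|) : trinomialCoeff R n k = 0 := by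
  induction n generalizing k with
  | zero => rw [zero_left, if_neg]; rintro rfl; simp at h
  | succ n ih => rw [succ_left, ih, ih, ih] <;> grind

theorem succ_zero (n : ℕ) :
    trinomialCoeff R (n + 1) 0 = trinomialCoeff R n 0 + 2 * trinomialCoeff R n 1 := by
  rw [succ_left, zero_sub, neg_right, zero_add]
  ring

theorem succ_one (n : ℕ) : trinomialCoeff R (n + 1) 1 =
    trinomialCoeff R n 0 + trinomialCoeff R n 1 + trinomialCoeff R n 2 := by
  rw [succ_left, sub_self, one_add_one_eq_two]

/-- The coefficient form of `x d/dx P ^ (n + 1) = (n + 1) P ^ n (x - x⁻¹)`, `P = x + 1 + x⁻¹`. -/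
theorem intCast_mul_succ_left (n : ℕ) (k : ℤ) : (k : R) * trinomialCoeff R (n + 1) k =
    (n + 1) * (trinomialCoeff R n (k - 1) - trinomialCoeff R n (k + 1)) := by
  induction n generalizing k with
  | zero =>
    simp only [succ_left, zero_left]
    by_cases h0 : k = 0
    · simp [h0]
    by_cases h1 : k = 1
    · simp [h1]
    by_cases h2 : k = -1
    · simp [h2]
    rw [if_neg (by omega), if_neg h0, if_neg (by omega)]
    simp
  | succ n ih =>
    have ih_left := ih (k - 1)
    have ih_right := ih (k + 1)
    rw [sub_add_cancel] at ih_left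
    rw [add_sub_cancel_right] at ih_right
    have expand_left := succ_left (R := R) n (k - 1)
    have expand_right := succ_left (R := R) n (k + 1)
    rw [sub_add_cancel] at expand_left
    rw [add_sub_cancel_right] at expand_right
    rw [succ_left (n + 1)]
    push_cast at ih_left ih_right ⊢
    linear_combination ih_left + ih k + ih_right - (n + 1) * expand_left + (n + 1) * expand_right

variable {p : ℕ} [Fact p.Prime] [CharP R p]

theorem add_prime_pow (i a : ℕ) (k : ℤ) :
    trinomialCoeff R (a + p ^ i) k = trinomialCoeff R a (k - (p ^ i : ℕ)) +
      trinomialCoeff R a k + trinomialCoeff R a (k + (p ^ i : ℕ)) := by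
  have := laurentPolynomial_charP (R := R) p
  simp only [trinomialCoeff, pow_add, add_pow_char_pow, T_pow, mul_add,
    AddMonoidAlgebra.coeff_add, Finsupp.add_apply, laurentPolynomial_coeff_mul_T, mul_one,
    mul_zero, sub_zero, mul_neg, sub_neg_eq_add]

theorem prime_pow_mul_add (i n : ℕ) {s : ℕ} {l : ℤ} (h : s + |l| < (p ^ i : ℕ)) (j : ℤ) :
    trinomialCoeff R (p ^ i * n + s) ((p ^ i : ℕ) * j + l) =
      trinomialCoeff R n j * trinomialCoeff R s l := by
  induction n generalizing j with
  | zero =>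
    rw [zero_left, mul_zero, zero_add]
    split_ifs with hj
    · rw [hj, mul_zero, zero_add, one_mul]
    · rw [zero_mul, eq_zero_of_lt_abs]
      have hq : ((p ^ i : ℕ) : ℤ) ≤ |((p ^ i : ℕ) : ℤ) * j| := by
        rw [abs_mul, Nat.abs_cast]
        exact le_mul_of_one_le_right (by positivity) (Int.one_le_abs hj)
      grind
  | succ n ih =>
    rw [mul_add_one, add_right_comm, add_prime_pow, succ_left, add_mul, add_mul, ← ih, ← ih, ← ih]
    ring_nf

end trinomialCoeff

/-! ### Lattice paths -/

theorem sum_latticePaths_T (R : Type*) [CommRing R] (n : ℕ) :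
    ∑ s ∈ latticePaths n, (LaurentPolynomial.T (∑ i, s i) : LaurentPolynomial R) =
      (LaurentPolynomial.T 1 + LaurentPolynomial.T 0 + LaurentPolynomial.T (-1)) ^ n := by
  simp only [laurentPolynomial_T_sum]
  rw [latticePaths, ← Finset.prod_univ_sum, Finset.prod_const, Finset.card_univ, Fintype.card_fin,
    Finset.sum_insert (by decide), Finset.sum_insert (by decide), Finset.sum_singleton]
  ring

theorem cast_card_latticePaths_sum_eq (R : Type*) [CommRing R] (n : ℕ) (k : ℤ) :
    (({s ∈ latticePaths n | ∑ i, s i = k}.card : ℕ) : R) = trinomialCoeff R n k := by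
  rw [trinomialCoeff, ← sum_latticePaths_T, AddMonoidAlgebra.coeff_sum, Finset.sum_apply']
  simp only [LaurentPolynomial.T_apply, Finset.sum_boole]

theorem cast_centralTrinomial (R : Type*) [CommRing R] (n : ℕ) :
    (centralTrinomial n : R) = trinomialCoeff R n 0 :=
  cast_card_latticePaths_sum_eq R n 0

/-- The lattice paths that never go below the horizontal axis and end at height `h`. -/
def nonnegPaths (n : ℕ) (h : ℤ) : Finset (Fin n → ℤ) :=
  (latticePaths n).filter fun s => ∑ i, s i = h ∧ ∀ j : Fin n, 0 ≤ ∑ i ∈ Finset.Iic j, s i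

namespace nonnegPaths

theorem eq_empty_of_neg {n : ℕ} {h : ℤ} (hh : h < 0) : nonnegPaths n h = ∅ := by
  rw [nonnegPaths, Finset.filter_eq_empty_iff]
  rintro s - ⟨rfl, hs⟩
  cases n with
  | zero => simp at hh
  | succ n => exact absurd (hs (Fin.last n)) (by rwa [← Fin.top_eq_last, Finset.Iic_top, not_le])

theorem snoc_mem_iff {n : ℕ} {h a : ℤ} (hh : 0 ≤ h) {s : Fin n → ℤ} :
    (Fin.snoc s a : Fin (n + 1) → ℤ) ∈ nonnegPaths (n + 1) h ↔
      a ∈ ({-1, 0, 1} : Finset ℤ) ∧ s ∈ nonnegPaths n (h - a) := by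
  simp only [nonnegPaths, latticePaths, Finset.mem_filter, Fintype.mem_piFinset,
    Fin.forall_fin_succ', Fin.sum_Iic_castSucc, ← Fin.top_eq_last, Finset.Iic_top]
  simp only [Fin.top_eq_last, Fin.sum_univ_castSucc, Fin.snoc_castSucc, Fin.snoc_last,
    eq_sub_iff_add_eq]
  grind

theorem card_succ (n : ℕ) {h : ℤ} (hh : 0 ≤ h) :
    (nonnegPaths (n + 1) h).card =
      (nonnegPaths n (h - 1)).card + (nonnegPaths n h).card + (nonnegPaths n (h + 1)).card := by
  have sum_last_step : (nonnegPaths (n + 1) h).card =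
      ∑ a ∈ ({-1, 0, 1} : Finset ℤ), (nonnegPaths n (h - a)).card := by
    rw [← Finset.card_sigma]
    refine Finset.card_bij' (fun s _ => ⟨s (Fin.last n), Fin.init s⟩)
      (fun x _ => (Fin.snoc x.2 x.1 : Fin (n + 1) → ℤ)) (fun s hs => ?_) (fun x hx => ?_)
      (fun s _ => Fin.snoc_init_self s) (fun x _ => by simp)
    · rw [← Fin.snoc_init_self s, snoc_mem_iff hh] at hs
      exact Finset.mem_sigma.2 hs
    · exact (snoc_mem_iff hh).2 (Finset.mem_sigma.1 hx)
  rw [sum_last_step, Finset.sum_insert (by decide), Finset.sum_insert (by decide),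
    Finset.sum_singleton, sub_neg_eq_add, sub_zero]
  ring

/-- Both sides vanish at height `h = -1` and satisfy the same recurrence above it: this is the
reflection principle. -/
theorem cast_card (R : Type*) [CommRing R] (n : ℕ) {h : ℤ} (hh : -1 ≤ h) :
    ((nonnegPaths n h).card : R) = trinomialCoeff R n h - trinomialCoeff R n (h + 2) := by
  have boundary (n : ℕ) : ((nonnegPaths n (-1)).card : R) =
      trinomialCoeff R n (-1) - trinomialCoeff R n (-1 + 2) := by
    rw [eq_empty_of_neg (by norm_num), trinomialCoeff.neg_right]
    norm_num
  induction n generalizing h with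
  | zero =>
    rcases hh.eq_or_lt with rfl | hh
    · exact boundary 0
    rw [trinomialCoeff.zero_left, trinomialCoeff.zero_left, if_neg (by omega : ¬ h + 2 = 0)]
    by_cases h0 : h = 0
    · simp [nonnegPaths, latticePaths, h0]
    · simp [nonnegPaths, h0, Ne.symm h0]
  | succ n ih =>
    rcases hh.eq_or_lt with rfl | hh
    · exact boundary (n + 1)
    rw [card_succ n (by omega), Nat.cast_add, Nat.cast_add, ih (by omega), ih (by omega),
      ih (by omega), trinomialCoeff.succ_left, trinomialCoeff.succ_left]
    ring_nf

end nonnegPaths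

theorem cast_motzkin (R : Type*) [CommRing R] (n : ℕ) :
    (motzkin n : R) = trinomialCoeff R n 0 - trinomialCoeff R n 2 :=
  nonnegPaths.cast_card R n (h := 0) (by norm_num)

theorem two_mul_motzkin (R : Type*) [CommRing R] (n : ℕ) : 2 * (motzkin n : R) =
    3 * centralTrinomial n + 2 * centralTrinomial (n + 1) - centralTrinomial (n + 2) := by
  simp only [cast_motzkin, cast_centralTrinomial, trinomialCoeff.succ_zero, trinomialCoeff.succ_one]
  ring

theorem centralTrinomial_recurrence (R : Type*) [CommRing R] (n : ℕ) :
    (n + 2) * (centralTrinomial (n + 2) : R) =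
      (2 * n + 3) * centralTrinomial (n + 1) + 3 * (n + 1) * centralTrinomial n := by
  have h := trinomialCoeff.intCast_mul_succ_left (R := R) n 1
  rw [Int.cast_one, one_mul, sub_self, one_add_one_eq_two, trinomialCoeff.succ_one] at h
  simp only [cast_centralTrinomial, trinomialCoeff.succ_zero, trinomialCoeff.succ_one]
  linear_combination 2 * h

theorem centralTrinomial_zero : centralTrinomial 0 = 1 := by
  decide +kernel

theorem centralTrinomial_one : centralTrinomial 1 = 1 := by
  decide +kernel

theorem centralTrinomial_two : centralTrinomial 2 = 3 := by
  decide +kernel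

/-! ### Congruences modulo a prime -/

section Congruences

variable {p : ℕ} [hp : Fact p.Prime]

theorem centralTrinomial_prime_pow_mul_add (i n : ℕ) {s : ℕ} (hs : s < p ^ i) :
    (centralTrinomial (p ^ i * n + s) : ZMod p) = centralTrinomial n * centralTrinomial s := by
  simpa only [cast_centralTrinomial, mul_zero, add_zero] using
    trinomialCoeff.prime_pow_mul_add (R := ZMod p) i n (s := s) (l := 0)
      (by simpa using mod_cast hs) 0

theorem motzkin_prime_pow_mul_add (i n : ℕ) {s : ℕ} (hs : s + 2 < p ^ i) :
    (motzkin (p ^ i * n + s) : ZMod p) = centralTrinomial n * motzkin s := by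
  have coeff_two := trinomialCoeff.prime_pow_mul_add (R := ZMod p) i n (s := s) (l := 2)
    (by rw [abs_two]; exact_mod_cast hs) 0
  rw [mul_zero, zero_add] at coeff_two
  rw [cast_motzkin, coeff_two, ← cast_centralTrinomial,
    centralTrinomial_prime_pow_mul_add i n (by omega), cast_motzkin, cast_centralTrinomial,
    cast_centralTrinomial, mul_sub]

theorem centralTrinomial_prime_mul_add (n : ℕ) {s : ℕ} (hs : s < p) :
    (centralTrinomial (p * n + s) : ZMod p) = centralTrinomial n * centralTrinomial s := by
  simpa only [pow_one] using centralTrinomial_prime_pow_mul_add 1 n (by rwa [pow_one])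

theorem motzkin_prime_mul_add (n : ℕ) {s : ℕ} (hs : s + 2 < p) :
    (motzkin (p * n + s) : ZMod p) = centralTrinomial n * motzkin s := by
  simpa only [pow_one] using motzkin_prime_pow_mul_add 1 n (by rwa [pow_one])

theorem centralTrinomial_prime_mul (n : ℕ) :
    (centralTrinomial (p * n) : ZMod p) = centralTrinomial n := by
  simpa only [add_zero, centralTrinomial_zero, Nat.cast_one, mul_one] using
    centralTrinomial_prime_mul_add (p := p) n hp.out.pos

theorem centralTrinomial_reflected_recurrence {a n : ℕ} (h : a + n + 1 = p) :
    (n - 1) * (centralTrinomial (a + 2) : ZMod p) =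
      (2 * n - 1) * centralTrinomial (a + 1) + 3 * n * centralTrinomial a := by
  have sum_eq_zero : (a + n + 1 : ZMod p) = 0 := by
    rw [← ZMod.natCast_self p]
    exact_mod_cast congrArg Nat.cast h
  have cast_a : (a : ZMod p) = -(n + 1) := by linear_combination sum_eq_zero
  have recurrence := centralTrinomial_recurrence (ZMod p) a
  rw [cast_a] at recurrence
  linear_combination -recurrence

theorem centralTrinomial_mul_neg_three_pow {a n : ℕ} (h : a + n + 1 = p) :
    (centralTrinomial a : ZMod p) * (-3) ^ n = centralTrinomial (p - 1) * centralTrinomial n := by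
  induction n using Nat.twoStepInduction generalizing a with
  | zero => rw [show p - 1 = a by omega, centralTrinomial_zero, pow_zero, Nat.cast_one]
  | one =>
    have recurrence := centralTrinomial_reflected_recurrence h
    rw [show p - 1 = a + 1 by omega, centralTrinomial_one]
    push_cast at recurrence ⊢
    linear_combination recurrence
  | more n ih ih' =>
    have reflect_succ := ih' (a := a + 1) (by omega)
    have reflect := ih (a := a + 2) (by omega)
    have recurrence := centralTrinomial_reflected_recurrence h
    have succ_succ_ne_zero : (n + 2 : ZMod p) ≠ 0 := by
      exact_mod_cast mt (ZMod.natCast_eq_zero_iff (n + 2) p).1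
        (Nat.not_dvd_of_pos_of_lt (by omega) (by omega))
    apply mul_left_cancel₀ succ_succ_ne_zero
    push_cast at recurrence
    linear_combination (2 * n + 3) * reflect_succ + 3 * (n + 1) * reflect +
      (-3) ^ (n + 1) * recurrence -
      centralTrinomial (p - 1) * centralTrinomial_recurrence (ZMod p) n

theorem neg_three_ne_zero (h3 : p ≠ 3) : (-3 : ZMod p) ≠ 0 := by
  rw [neg_ne_zero]
  exact_mod_cast mt (ZMod.natCast_eq_zero_iff 3 p).1
    (mt (Nat.prime_dvd_prime_iff_eq hp.out Nat.prime_three).1 h3)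

theorem centralTrinomial_pred_mul_self (h3 : p ≠ 3) :
    (centralTrinomial (p - 1) * centralTrinomial (p - 1) : ZMod p) = 1 := by
  rw [← centralTrinomial_mul_neg_three_pow (a := 0) (by have := hp.out.pos; omega),
    ZMod.pow_card_sub_one_eq_one (neg_three_ne_zero h3), centralTrinomial_zero, Nat.cast_one,
    mul_one]

theorem two_mul_motzkin_prime_mul_add_sub_two (hp2 : 2 ≤ p) (n : ℕ) :
    2 * (motzkin (p * n + (p - 2)) : ZMod p) =
      centralTrinomial (p - 1) * centralTrinomial n - centralTrinomial (n + 1) := by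
  have reflect := centralTrinomial_mul_neg_three_pow (p := p) (a := p - 2) (n := 1) (by omega)
  rw [centralTrinomial_one, pow_one, Nat.cast_one, mul_one] at reflect
  rw [two_mul_motzkin, show p * n + (p - 2) + 1 = p * n + (p - 1) by omega,
    show p * n + (p - 2) + 2 = p * (n + 1) by rw [mul_add_one]; omega,
    centralTrinomial_prime_mul_add n (by omega), centralTrinomial_prime_mul_add n (by omega),
    centralTrinomial_prime_mul]
  linear_combination -(centralTrinomial n : ZMod p) * reflect

theorem two_mul_motzkin_prime_mul_add_sub_one (n : ℕ) :
    2 * (motzkin (p * n + (p - 1)) : ZMod p) =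
      3 * centralTrinomial (p - 1) * centralTrinomial n + centralTrinomial (n + 1) := by
  have one_lt := hp.out.one_lt
  rw [two_mul_motzkin, show p * n + (p - 1) + 1 = p * (n + 1) by rw [mul_add_one]; omega,
    show p * n + (p - 1) + 2 = p * (n + 1) + 1 by rw [mul_add_one]; omega,
    centralTrinomial_prime_mul_add n (by omega), centralTrinomial_prime_mul_add (n + 1) one_lt,
    centralTrinomial_prime_mul, centralTrinomial_one]
  push_cast
  ring

theorem centralTrinomial_cast_ne_zero (hT : ∀ n < p, ¬ p ∣ centralTrinomial n) (n : ℕ) :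
    (centralTrinomial n : ZMod p) ≠ 0 := by
  induction n using Nat.strong_induction_on with
  | _ n ih =>
    rcases lt_or_ge n p with h | h
    · rw [Ne, ZMod.natCast_eq_zero_iff]
      exact hT n h
    · have n_mod_lt := Nat.mod_lt n hp.out.pos
      rw [← Nat.div_add_mod n p, centralTrinomial_prime_mul_add _ n_mod_lt]
      exact mul_ne_zero (ih _ (Nat.div_lt_self (hp.out.pos.trans_le h) hp.out.one_lt))
        (ih _ (n_mod_lt.trans_le h))

end Congruences

theorem ne_three_of_not_dvd_centralTrinomial {p : ℕ} (hT : ∀ n < p, ¬ p ∣ centralTrinomial n) :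
    p ≠ 3 := by
  rintro rfl
  exact hT 2 (by norm_num) (by rw [centralTrinomial_two])

/-! ### Cesàro means -/

/-- The sum of the entries of `u` over the `n`-th block of length `q`, blocks being numbered
from `0`. -/
def blockSum {E : Type*} [AddCommMonoid E] (q : ℕ) (u : ℕ → E) (n : ℕ) : E :=
  ∑ s ∈ Finset.range q, u (q * n + s)

/-- The sequence `u` has Cesàro mean `m` (the limit exists and equals `m`). -/
def HasMean {E : Type*} [NormedAddCommGroup E] [NormedSpace ℝ E] (u : ℕ → E) (m : E) : Prop :=
  Tendsto (fun N : ℕ => (N : ℝ)⁻¹ • ∑ n ∈ Finset.range N, u n) atTop (𝓝 m)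

theorem sum_range_mul_eq_sum_blockSum {E : Type*} [AddCommMonoid E] (q r : ℕ) (u : ℕ → E) :
    ∑ n ∈ Finset.range (q * r), u n = ∑ j ∈ Finset.range r, blockSum q u j := by
  induction r with
  | zero => rfl
  | succ r ih => rw [mul_add_one, Finset.sum_range_add, ih, Finset.sum_range_succ, blockSum]

theorem blockSum_mul {E : Type*} [AddCommMonoid E] (q r : ℕ) (u : ℕ → E) :
    blockSum (q * r) u = blockSum r (blockSum q u) := by
  funext n
  rw [blockSum, sum_range_mul_eq_sum_blockSum]
  simp only [blockSum, mul_add, mul_assoc, add_assoc]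

theorem blockSum_pow_of_blockSum_eq_smul {R E ι : Type*} [Monoid R] [AddCommMonoid E]
    [DistribMulAction R E] {q : ℕ} {c : R} {w : ι → ℕ → E} {σ : ι → ι}
    (hw : ∀ i n, blockSum q (w i) n = c • w (σ i) n) (k : ℕ) (i : ι) (n : ℕ) :
    blockSum (q ^ k) (w i) n = c ^ k • w (σ^[k] i) n := by
  induction k generalizing i n with
  | zero => simp [blockSum]
  | succ k ih =>
    rw [pow_succ', blockSum_mul, funext (hw i), blockSum, ← Finset.smul_sum, ← blockSum, ih,
      smul_smul, pow_succ', Function.iterate_succ_apply]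

section NormedSpace

variable {E : Type*} [NormedAddCommGroup E]

theorem norm_sum_range_sub_sum_blockSum_le {u : ℕ → E} {C : ℝ} (hu : ∀ n, ‖u n‖ ≤ C) {q : ℕ}
    (hq : 0 < q) (N : ℕ) :
    ‖∑ n ∈ Finset.range N, u n - ∑ j ∈ Finset.range (N / q), blockSum q u j‖ ≤ q * C := by
  have hC : 0 ≤ C := (norm_nonneg _).trans (hu 0)
  rw [← sum_range_mul_eq_sum_blockSum]
  nth_rewrite 1 [← Nat.div_add_mod N q]
  rw [Finset.sum_range_add, add_sub_cancel_left]
  calc ‖∑ s ∈ Finset.range (N % q), u (q * (N / q) + s)‖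
      ≤ ∑ _s ∈ Finset.range (N % q), C := norm_sum_le_of_le _ fun s _ => hu _
    _ ≤ q * C := by
      rw [Finset.sum_const, Finset.card_range, nsmul_eq_mul]
      gcongr
      exact (Nat.mod_lt N hq).le

variable [NormedSpace ℝ E]

theorem norm_sum_range_sub_smul_sum_range_div_le {u v : ℕ → E} {C ε : ℝ} (hu : ∀ n, ‖u n‖ ≤ C)
    {q : ℕ} (hq : 0 < q) (huv : ∀ n, ‖blockSum q u n - (q : ℝ) • v n‖ ≤ q * ε) (N : ℕ) :
    ‖∑ n ∈ Finset.range N, u n - (q : ℝ) • ∑ j ∈ Finset.range (N / q), v j‖ ≤ q * C + N * ε := by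
  have hε : 0 ≤ ε := nonneg_of_mul_nonneg_right ((norm_nonneg _).trans (huv 0)) (by positivity)
  have blocks_close : ‖∑ j ∈ Finset.range (N / q), blockSum q u j -
      (q : ℝ) • ∑ j ∈ Finset.range (N / q), v j‖ ≤ N * ε := by
    rw [Finset.smul_sum, ← Finset.sum_sub_distrib]
    refine (norm_sum_le_of_le _ fun n _ => huv n).trans ?_
    rw [Finset.sum_const, Finset.card_range, nsmul_eq_mul, ← mul_assoc]
    gcongr
    exact_mod_cast Nat.div_mul_le_self N q
  exact (norm_sub_le_norm_sub_add_norm_sub _ _ _).trans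
    (add_le_add (norm_sum_range_sub_sum_blockSum_le hu hq N) blocks_close)

namespace HasMean

theorem const (m : E) : HasMean (fun _ => m) m := by
  refine tendsto_const_nhds.congr' ?_
  filter_upwards [eventually_ne_atTop 0] with N hN
  rw [Finset.sum_const, Finset.card_range, ← Nat.cast_smul_eq_nsmul ℝ,
    inv_smul_smul₀ (Nat.cast_ne_zero.2 hN)]

theorem add {u v : ℕ → E} {m l : E} (hu : HasMean u m) (hv : HasMean v l) :
    HasMean (fun n => u n + v n) (m + l) := by
  simpa only [HasMean, Finset.sum_add_distrib, smul_add] using Tendsto.add hu hv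

theorem sub {u v : ℕ → E} {m l : E} (hu : HasMean u m) (hv : HasMean v l) :
    HasMean (fun n => u n - v n) (m - l) := by
  simpa only [HasMean, Finset.sum_sub_distrib, smul_sub] using Tendsto.sub hu hv

theorem sum {ι : Type*} {s : Finset ι} {u : ι → ℕ → E} {m : ι → E}
    (h : ∀ i ∈ s, HasMean (u i) (m i)) : HasMean (fun n => ∑ i ∈ s, u i n) (∑ i ∈ s, m i) := by
  refine (tendsto_finsetSum s h).congr fun N => ?_
  rw [Finset.sum_comm, Finset.smul_sum]

theorem const_smul {𝕜 : Type*} [NormedField 𝕜] [NormedSpace 𝕜 E] [SMulCommClass 𝕜 ℝ E] (c : 𝕜)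
    {u : ℕ → E} {m : E} (h : HasMean u m) : HasMean (fun n => c • u n) (c • m) := by
  refine (Tendsto.const_smul h c).congr fun N => ?_
  rw [smul_comm, Finset.smul_sum]

theorem tendsto_smul_sum_range_div {v : ℕ → E} {m : E} (h : HasMean v m) {q : ℕ} (hq : 0 < q) :
    Tendsto (fun N : ℕ => (N : ℝ)⁻¹ • (q : ℝ) • ∑ j ∈ Finset.range (N / q), v j) atTop (𝓝 m) := by
  have hq' : (q : ℝ) ≠ 0 := by positivity
  have ratio : Tendsto (fun N : ℕ => q * (((N / q : ℕ) : ℝ) / N)) atTop (𝓝 1) := by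
    have := ((tendsto_nat_floor_mul_div_atTop (R := ℝ) (a := (q : ℝ)⁻¹) (by positivity)).comp
      tendsto_natCast_atTop_atTop).const_mul (q : ℝ)
    simpa only [Function.comp_def, inv_mul_eq_div, Nat.floor_div_eq_div, mul_inv_cancel₀ hq']
      using this
  have := ratio.smul (h.comp (Nat.tendsto_div_const_atTop hq.ne'))
  rw [one_smul] at this
  refine this.congr' ?_
  filter_upwards [eventually_ge_atTop q] with N hN
  have : ((N / q : ℕ) : ℝ) ≠ 0 := Nat.cast_ne_zero.2 (Nat.div_pos hN hq).ne'
  rw [Function.comp_apply, smul_smul, smul_smul]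
  congr 1
  field_simp

theorem of_norm_blockSum_sub_le {u : ℕ → E} {C : ℝ} (hu : ∀ n, ‖u n‖ ≤ C) {m : E}
    (approx : ∀ ε > (0 : ℝ), ∃ q > 0, ∃ v : ℕ → E,
      HasMean v m ∧ ∀ n, ‖blockSum q u n - (q : ℝ) • v n‖ ≤ q * ε) : HasMean u m := by
  refine Metric.tendsto_nhds.2 fun ε hε => ?_
  obtain ⟨q, hq, v, hv, huv⟩ := approx (ε / 3) (by positivity)
  have boundary_small : Tendsto (fun N : ℕ => (N : ℝ)⁻¹ * (q * C)) atTop (𝓝 0) := by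
    simpa using tendsto_inv_atTop_nhds_zero_nat.mul_const (q * C : ℝ)
  filter_upwards [eventually_gt_atTop 0,
    Metric.tendsto_nhds.1 (hv.tendsto_smul_sum_range_div hq) _ (by positivity : 0 < ε / 3),
    boundary_small.eventually_lt_const (by positivity : 0 < ε / 3)] with N hN hvN hCN
  have means_close : dist ((N : ℝ)⁻¹ • ∑ n ∈ Finset.range N, u n)
      ((N : ℝ)⁻¹ • (q : ℝ) • ∑ j ∈ Finset.range (N / q), v j) ≤
        (N : ℝ)⁻¹ * (q * C + N * (ε / 3)) := by
    rw [dist_eq_norm, ← smul_sub, norm_smul_of_nonneg (by positivity)]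
    gcongr
    exact norm_sum_range_sub_smul_sum_range_div_le hu hq huv N
  rw [mul_add, inv_mul_cancel_left₀ (by positivity)] at means_close
  linarith [dist_triangle ((N : ℝ)⁻¹ • ∑ n ∈ Finset.range N, u n)
    ((N : ℝ)⁻¹ • (q : ℝ) • ∑ j ∈ Finset.range (N / q), v j) m]

theorem of_blockSum {u : ℕ → E} {C : ℝ} (hu : ∀ n, ‖u n‖ ≤ C) {q : ℕ} (hq : 0 < q) {m : E}
    (h : HasMean (blockSum q u) ((q : ℝ) • m)) : HasMean u m := by
  have hq' : (q : ℝ) ≠ 0 := by positivity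
  refine of_norm_blockSum_sub_le hu fun ε hε =>
    ⟨q, hq, fun n => (q : ℝ)⁻¹ • blockSum q u n, ?_, fun n => ?_⟩
  · simpa only [inv_smul_smul₀ hq'] using h.const_smul (q : ℝ)⁻¹
  · rw [smul_inv_smul₀ hq', sub_self, norm_zero]
    positivity

theorem zero_of_blockSum_eq_smul {𝕜 ι : Type*} [NormedField 𝕜] [NormedSpace 𝕜 E] {q : ℕ} {c : 𝕜}
    {w : ι → ℕ → E} {σ : ι → ι} {C : ℝ} (bounded : ∀ i n, ‖w i n‖ ≤ C)
    (hw : ∀ i n, blockSum q (w i) n = c • w (σ i) n) (hc : ‖c‖ < q) (i : ι) :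
    HasMean (w i) 0 := by
  have hq : (0 : ℝ) < q := (norm_nonneg c).trans_lt hc
  have decay : Tendsto (fun k : ℕ => (‖c‖ / q) ^ k * C) atTop (𝓝 0) := by
    simpa only [zero_mul] using (tendsto_pow_atTop_nhds_zero_of_lt_one (by positivity)
      ((div_lt_one hq).2 hc)).mul_const C
  refine of_norm_blockSum_sub_le (bounded i) fun ε hε => ?_
  obtain ⟨k, hk⟩ := (decay.eventually_lt_const hε).exists
  refine ⟨q ^ k, pow_pos (Nat.cast_pos.1 hq) k, fun _ => 0, const 0, fun n => ?_⟩
  rw [smul_zero, sub_zero, blockSum_pow_of_blockSum_eq_smul hw, norm_smul, norm_pow]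
  calc ‖c‖ ^ k * ‖w (σ^[k] i) n‖ ≤ ‖c‖ ^ k * C := by gcongr; exact bounded _ n
    _ = q ^ k * ((‖c‖ / q) ^ k * C) := by rw [div_pow]; field_simp
    _ ≤ (q ^ k : ℕ) * ε := by push_cast; gcongr

end HasMean

end NormedSpace

theorem hasAsympDensity_iff_hasMean {P : ℕ → Prop} [DecidablePred P] {d : ℝ} (𝕜 : Type*)
    [RCLike 𝕜] : HasAsympDensity {n | P n} d ↔ HasMean (fun n => if P n then (1 : 𝕜) else 0) d := by
  have ncard_eq (N : ℕ) : ({n | P n} ∩ Set.Iio N).ncard = ((Finset.range N).filter P).card := by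
    rw [← Set.ncard_coe_finset]
    congr 1
    ext n
    simp [and_comm]
  rw [HasAsympDensity, ← tendsto_ofReal_iff' (𝕜 := 𝕜), HasMean]
  simp only [ncard_eq, Finset.sum_boole, RCLike.real_smul_eq_coe_mul, div_eq_inv_mul]
  simp

/-! ### Values along characters -/

theorem norm_sum_lt_card {ι E : Type*} [NormedAddCommGroup E] [NormedSpace ℝ E]
    [StrictConvexSpace ℝ E] {s : Finset ι} {f : ι → E} (hf : ∀ i ∈ s, ‖f i‖ ≤ 1) {i j : ι}
    (hi : i ∈ s) (hj : j ∈ s) (hij : f i ≠ f j) : ‖∑ k ∈ s, f k‖ < s.card := by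
  have card_pos : (0 : ℝ) < s.card := Nat.cast_pos.2 (Finset.card_pos.2 ⟨i, hi⟩)
  have average_lt : ‖∑ k ∈ s, (s.card : ℝ)⁻¹ • f k‖ < 1 :=
    norm_sum_lt_of_strictConvexSpace (fun _ _ => by positivity) (by simp [card_pos.ne']) hi hj hij
      (by positivity) (by positivity) hf
  rwa [← Finset.smul_sum, norm_smul_of_nonneg (by positivity), inv_mul_lt_one₀ card_pos]
    at average_lt

theorem ValueHasDensity.of_hasMean_character {n : ℕ} [NeZero n] {u : ℕ → ZMod n} {d : ℝ}
    (hu : HasMean (fun k => (1 : DirichletCharacter ℂ n) (u k)) d)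
    (hχ : ∀ χ : DirichletCharacter ℂ n, χ ≠ 1 → HasMean (fun k => χ (u k)) 0)
    {x : ZMod n} (hx : IsUnit x) : ValueHasDensity u x (d / n.totient) := by
  classical
  have mean_character (χ : DirichletCharacter ℂ n) :
      HasMean (fun k => χ (u k)) (if χ = 1 then (d : ℂ) else 0) := by
    split_ifs with h
    · exact h ▸ hu
    · exact hχ χ h
  have totient_ne_zero : (n.totient : ℂ) ≠ 0 := by
    exact_mod_cast (Nat.totient_pos.2 (NeZero.pos n)).ne'
  have mean_sum := (HasMean.sum (s := Finset.univ)
    fun χ _ => (mean_character χ).const_smul (χ x⁻¹)).const_smul (n.totient : ℂ)⁻¹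
  have inv_isUnit : IsUnit x⁻¹ := .of_mul_eq_one x (ZMod.inv_mul_of_unit x hx)
  rw [ValueHasDensity, hasAsympDensity_iff_hasMean ℂ]
  simpa [DirichletCharacter.sum_char_inv_mul_char_eq, hx, inv_isUnit, totient_ne_zero,
    MulChar.one_apply, div_eq_inv_mul, eq_comm] using mean_sum

section Characters

variable {p : ℕ} [hp : Fact p.Prime]

theorem hasMean_character_centralTrinomial (χ : DirichletCharacter ℂ p)
    (hχ : ∃ m < p, χ (centralTrinomial m) ≠ 1) : HasMean (fun n => χ (centralTrinomial n)) 0 := by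
  obtain ⟨m, hm, hne⟩ := hχ
  have eigenvalue_lt : ‖∑ s ∈ Finset.range p, χ (centralTrinomial s)‖ < p := by
    have ne_value_zero : χ (centralTrinomial m) ≠ χ (centralTrinomial 0) := by
      rwa [centralTrinomial_zero, Nat.cast_one, map_one]
    simpa only [Finset.card_range] using norm_sum_lt_card (fun s _ => χ.norm_le_one _)
      (Finset.mem_range.2 hm) (Finset.mem_range.2 hp.out.pos) ne_value_zero
  refine HasMean.zero_of_blockSum_eq_smul (ι := Unit) (w := fun _ n => χ (centralTrinomial n))
    (σ := id) (fun _ n => χ.norm_le_one _) (fun _ n => ?_) eigenvalue_lt ()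
  rw [blockSum, smul_eq_mul, Finset.sum_mul]
  refine Finset.sum_congr rfl fun s hs => ?_
  rw [centralTrinomial_prime_mul_add n (Finset.mem_range.1 hs), map_mul, mul_comm]

theorem norm_blockSum_character_motzkin_sub_le (χ : DirichletCharacter ℂ p) {i : ℕ}
    (hi : 2 ≤ p ^ i) (n : ℕ) :
    ‖blockSum (p ^ i) (fun k => χ (motzkin k)) n -
      (∑ s ∈ Finset.range (p ^ i), χ (motzkin s)) * χ (centralTrinomial n)‖ ≤ 4 := by
  have error_le (s : ℕ) :
      ‖χ (motzkin (p ^ i * n + s)) - χ (motzkin s) * χ (centralTrinomial n)‖ ≤ 2 := by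
    rw [← one_add_one_eq_two, ← map_mul]
    exact norm_sub_le_of_le (χ.norm_le_one _) (χ.norm_le_one _)
  obtain ⟨k, hk⟩ := Nat.exists_eq_add_of_le' hi
  have error_eq_zero : ∀ s ∈ Finset.range k,
      χ (motzkin (p ^ i * n + s)) - χ (motzkin s) * χ (centralTrinomial n) = 0 := fun s hs => by
    have := Finset.mem_range.1 hs
    rw [motzkin_prime_pow_mul_add i n (by omega), map_mul, mul_comm, sub_self]
  rw [blockSum, Finset.sum_mul, ← Finset.sum_sub_distrib]
  nth_rewrite 1 [hk]
  rw [Finset.sum_range_succ, Finset.sum_range_succ, Finset.sum_eq_zero error_eq_zero, zero_add]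
  exact (norm_add_le_of_le (error_le _) (error_le _)).trans (by norm_num)

theorem hasMean_character_motzkin (χ : DirichletCharacter ℂ p)
    (hχ : ∃ m < p, χ (centralTrinomial m) ≠ 1) : HasMean (fun n => χ (motzkin n)) 0 := by
  refine HasMean.of_norm_blockSum_sub_le (fun n => χ.norm_le_one _) fun ε hε => ?_
  obtain ⟨i, hi⟩ := pow_unbounded_of_one_lt (max 2 (4 / ε)) (Nat.one_lt_cast.2 hp.out.one_lt)
  obtain ⟨two_lt, four_lt⟩ := max_lt_iff.1 hi
  have two_le : 2 ≤ p ^ i := by exact_mod_cast two_lt.le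
  refine ⟨p ^ i, by omega, fun n =>
    ((∑ s ∈ Finset.range (p ^ i), χ (motzkin s)) / (p ^ i : ℕ)) • χ (centralTrinomial n), ?_,
    fun n => ?_⟩
  · simpa only [smul_zero] using (hasMean_character_centralTrinomial χ hχ).const_smul _
  · have ne_zero : ((p ^ i : ℕ) : ℂ) ≠ 0 := Nat.cast_ne_zero.2 (by omega)
    dsimp only
    rw [smul_eq_mul, Complex.real_smul, Complex.ofReal_natCast, ← mul_assoc,
      mul_div_cancel₀ _ ne_zero]
    refine (norm_blockSum_character_motzkin_sub_le χ two_le n).trans ?_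
    rw [div_lt_iff₀ hε] at four_lt
    exact_mod_cast four_lt.le

theorem exists_character_centralTrinomial_ne_one (h : TrinomialGenerationConjectureAt p)
    {χ : DirichletCharacter ℂ p} (hχ : χ ≠ 1) : ∃ m < p, χ (centralTrinomial m) ≠ 1 := by
  by_contra! all_one
  have not_dvd : ∀ n < p, ¬ p ∣ centralTrinomial n := fun n hn hdvd => by
    have := all_one n hn
    rw [(ZMod.natCast_eq_zero_iff _ _).2 hdvd, MulChar.map_zero] at this
    exact zero_ne_one this
  have ker_eq_top : χ.toUnitHom.ker = ⊤ := by
    rw [eq_top_iff, ← h not_dvd, Subgroup.closure_le]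
    rintro g ⟨n, hn, hg⟩
    rw [SetLike.mem_coe, MonoidHom.mem_ker, Units.ext_iff, MulChar.coe_toUnitHom, hg,
      all_one n hn, Units.val_one]
  refine hχ (MulChar.ext fun g => ?_)
  have mem_ker : g ∈ χ.toUnitHom.ker := ker_eq_top ▸ Subgroup.mem_top g
  rw [MulChar.one_apply_coe, ← MulChar.coe_toUnitHom, MonoidHom.mem_ker.1 mem_ker, Units.val_one]

end Characters

/-! ### Ratios of consecutive central trinomial coefficients -/

/-- The number of `m < p - 1` with `T_{m+1} = c T_m` in `ZMod p`. -/
def ratioCount (p : ℕ) (c : ZMod p) : ℕ :=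
  {m ∈ Finset.range (p - 1) |
    (centralTrinomial (m + 1) : ZMod p) = c * centralTrinomial m}.card

/-- The density of the indices `n` with `T_{n+1} = c T_n` in `ZMod p`, when no `T_n` vanishes. It
is the solution `ρ` of the system `p ρ(c) = N(c) + ρ(ε c)`, where `N` is `ratioCount p` and
`ε = T_{p-1}` satisfies `ε ^ 2 = 1`. -/
noncomputable def ratioDensity (p : ℕ) (c : ZMod p) : ℝ :=
  (p * ratioCount p c + ratioCount p (centralTrinomial (p - 1) * c)) / ((p - 1) * (p + 1))

section Ratios

variable {p : ℕ} [hp : Fact p.Prime]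

theorem prime_mul_ratioDensity (h3 : p ≠ 3) (c : ZMod p) :
    p * ratioDensity p c = ratioCount p c + ratioDensity p (centralTrinomial (p - 1) * c) := by
  have one_lt : (1 : ℝ) < p := by exact_mod_cast hp.out.one_lt
  have sub_ne_zero : (p : ℝ) - 1 ≠ 0 := by linarith
  rw [ratioDensity, ratioDensity, ← mul_assoc (centralTrinomial (p - 1) : ZMod p),
    centralTrinomial_pred_mul_self h3, one_mul]
  field_simp
  ring

theorem ratioCount_neg_three_mul (h3 : p ≠ 3) (c : ZMod p) :
    ratioCount p (-3 * c) = {m ∈ Finset.range (p - 1) |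
      (centralTrinomial m : ZMod p) = c * centralTrinomial (m + 1)}.card := by
  rw [ratioCount, Finset.card_filter, Finset.card_filter, ← Finset.sum_range_reflect]
  refine Finset.sum_congr rfl fun m hm => if_congr ?_ rfl rfl
  have hm := Finset.mem_range.1 hm
  have reflect := centralTrinomial_mul_neg_three_pow (p := p) (a := m + 1) (n := p - 1 - 1 - m)
    (by omega)
  have reflect_succ := centralTrinomial_mul_neg_three_pow (p := p) (a := m)
    (n := p - 1 - 1 - m + 1) (by omega)
  have last_ne_zero : (centralTrinomial (p - 1) : ZMod p) ≠ 0 :=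
    left_ne_zero_of_mul_eq_one (centralTrinomial_pred_mul_self h3)
  have pow_ne_zero : (-3 : ZMod p) ^ (p - 1 - 1 - m + 1) ≠ 0 :=
    pow_ne_zero _ (neg_three_ne_zero h3)
  rw [← mul_right_inj' last_ne_zero, ← reflect_succ, mul_left_comm, ← reflect]
  rw [show -3 * c * ((centralTrinomial (m + 1) : ZMod p) * (-3) ^ (p - 1 - 1 - m)) =
    c * centralTrinomial (m + 1) * (-3) ^ (p - 1 - 1 - m + 1) by ring, mul_left_inj' pow_ne_zero]

theorem ratioCount_eq_card_of_mul_self {c : ZMod p} (hc : c * c = 1) :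
    ratioCount p c = {m ∈ Finset.range (p - 1) |
      (centralTrinomial m : ZMod p) = c * centralTrinomial (m + 1)}.card := by
  refine congrArg Finset.card (Finset.filter_congr fun m _ => ?_)
  constructor <;> intro h <;> rw [h, ← mul_assoc, hc, one_mul]

theorem ratioCount_neg_three_mul_of_mul_self (h3 : p ≠ 3) {c : ZMod p} (hc : c * c = 1) :
    ratioCount p (-3 * c) = ratioCount p c := by
  rw [ratioCount_neg_three_mul h3, ratioCount_eq_card_of_mul_self hc]

theorem motzkinZeroDensity_eq_ratioCount (h3 : p ≠ 3) : motzkinZeroDensity p =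
    ({n ∈ Finset.range (p - 2) | (motzkin n : ZMod p) = 0}.card : ℝ) / p +
      2 * ratioCount p (centralTrinomial (p - 1)) / ((p - 1) * (p + 1)) +
      2 * ratioCount p 1 / ((p - 1) * p * (p + 1)) := by
  rw [ratioCount_eq_card_of_mul_self (centralTrinomial_pred_mul_self h3),
    ratioCount_eq_card_of_mul_self (one_mul 1)]
  simp only [one_mul, motzkinZeroDensity]

theorem prime_mul_motzkinZeroDensity (h3 : p ≠ 3) : p * motzkinZeroDensity p =
    {n ∈ Finset.range (p - 2) | (motzkin n : ZMod p) = 0}.card +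
      ratioDensity p (centralTrinomial (p - 1)) +
      ratioDensity p (-3 * centralTrinomial (p - 1)) := by
  have last_mul_self := centralTrinomial_pred_mul_self h3
  have one_lt : (1 : ℝ) < p := by exact_mod_cast hp.out.one_lt
  have sub_ne_zero : (p : ℝ) - 1 ≠ 0 := by linarith
  rw [motzkinZeroDensity_eq_ratioCount h3, ratioDensity, ratioDensity, mul_left_comm _ (-3),
    last_mul_self, ratioCount_neg_three_mul_of_mul_self h3 last_mul_self,
    ratioCount_neg_three_mul_of_mul_self h3 (one_mul 1)]
  field_simp
  ring

theorem ratioCount_one_pos (hp2 : 2 ≤ p) : 0 < ratioCount p 1 :=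
  Finset.card_pos.2 ⟨0, Finset.mem_filter.2 ⟨Finset.mem_range.2 (by omega), by
    rw [centralTrinomial_one, centralTrinomial_zero, one_mul]⟩⟩

theorem ratioCount_centralTrinomial_pred_pos (hp2 : 2 < p) (h3 : p ≠ 3) :
    0 < ratioCount p (centralTrinomial (p - 1)) := by
  rcases mul_self_eq_one_iff.1 (centralTrinomial_pred_mul_self h3) with h | h
  · exact h ▸ ratioCount_one_pos hp2.le
  · rw [h, ← ratioCount_neg_three_mul_of_mul_self h3 (by norm_num)]
    refine Finset.card_pos.2 ⟨1, Finset.mem_filter.2 ⟨Finset.mem_range.2 (by omega), ?_⟩⟩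
    rw [centralTrinomial_two, centralTrinomial_one]
    norm_num

theorem two_div_le_motzkinZeroDensity (hp2 : 2 < p) (h3 : p ≠ 3) :
    2 / ((p : ℝ) * (p - 1)) ≤ motzkinZeroDensity p := by
  have one_lt : (1 : ℝ) < p := by exact_mod_cast hp.out.one_lt
  have sub_pos : (0 : ℝ) < p - 1 := by linarith
  have last_pos : (1 : ℝ) ≤ ratioCount p (centralTrinomial (p - 1)) := by
    exact_mod_cast ratioCount_centralTrinomial_pred_pos hp2 h3
  have one_pos : (1 : ℝ) ≤ ratioCount p 1 := by exact_mod_cast ratioCount_one_pos hp2.le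
  calc 2 / ((p : ℝ) * (p - 1))
      = 0 + 2 * 1 / ((p - 1) * (p + 1)) + 2 * 1 / ((p - 1) * p * (p + 1)) := by
        field_simp
        ring
    _ ≤ motzkinZeroDensity p := by
        rw [motzkinZeroDensity_eq_ratioCount h3]
        gcongr
        positivity

theorem centralTrinomial_ratio_prime_mul_add_iff (hT : ∀ n < p, ¬ p ∣ centralTrinomial n)
    (c : ZMod p) (n : ℕ) {s : ℕ} (hs : s + 1 < p) :
    (centralTrinomial (p * n + s + 1) : ZMod p) = c * centralTrinomial (p * n + s) ↔
      (centralTrinomial (s + 1) : ZMod p) = c * centralTrinomial s := by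
  rw [add_assoc, centralTrinomial_prime_mul_add n hs,
    centralTrinomial_prime_mul_add n (Nat.lt_of_succ_lt hs), mul_left_comm,
    mul_right_inj' (centralTrinomial_cast_ne_zero hT n)]

theorem blockSum_centralTrinomial_ratio (hT : ∀ n < p, ¬ p ∣ centralTrinomial n) (c : ZMod p)
    (n : ℕ) :
    blockSum p (fun k => if (centralTrinomial (k + 1) : ZMod p) = c * centralTrinomial k
        then (1 : ℝ) else 0) n =
      ratioCount p c + if (centralTrinomial (n + 1) : ZMod p) =
        centralTrinomial (p - 1) * c * centralTrinomial n then 1 else 0 := by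
  have one_le := hp.out.one_le
  rw [blockSum, show Finset.range p = Finset.range (p - 1 + 1) by rw [Nat.sub_add_cancel one_le],
    Finset.sum_range_succ, ratioCount, ← Finset.sum_boole]
  congr 1
  · refine Finset.sum_congr rfl fun s hs => if_congr ?_ rfl rfl
    exact centralTrinomial_ratio_prime_mul_add_iff hT c n (by grind)
  · rw [add_assoc, Nat.sub_add_cancel one_le, ← mul_add_one, centralTrinomial_prime_mul,
      centralTrinomial_prime_mul_add n (by omega), mul_comm (centralTrinomial (p - 1) : ZMod p) c,
      mul_assoc, mul_comm (centralTrinomial n : ZMod p)]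

theorem hasMean_centralTrinomial_ratio (hT : ∀ n < p, ¬ p ∣ centralTrinomial n) (c : ZMod p) :
    HasMean (fun n => if (centralTrinomial (n + 1) : ZMod p) = c * centralTrinomial n
      then (1 : ℝ) else 0) (ratioDensity p c) := by
  set centered : ZMod p → ℕ → ℝ := fun c n =>
    (if (centralTrinomial (n + 1) : ZMod p) = c * centralTrinomial n then (1 : ℝ) else 0) -
      ratioDensity p c with centered_def
  obtain ⟨C, hC⟩ := (Set.finite_range fun c => ‖ratioDensity p c‖).bddAbove
  have bounded (c : ZMod p) (n : ℕ) : ‖centered c n‖ ≤ 1 + C := by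
    refine norm_sub_le_of_le ?_ (hC ⟨c, rfl⟩)
    split_ifs <;> simp
  have blockSum_centered (c : ZMod p) (n : ℕ) :
      blockSum p (centered c) n = (1 : ℝ) • centered (centralTrinomial (p - 1) * c) n := by
    have := blockSum_centralTrinomial_ratio hT c n
    have density := prime_mul_ratioDensity (ne_three_of_not_dvd_centralTrinomial hT) c
    rw [blockSum] at this
    rw [blockSum, Finset.sum_sub_distrib, this, Finset.sum_const, Finset.card_range, nsmul_eq_mul,
      density, one_smul]
    ring
  have mean_centered : HasMean (centered c) 0 := HasMean.zero_of_blockSum_eq_smul bounded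
    blockSum_centered (by rw [norm_one]; exact_mod_cast hp.out.one_lt) c
  simpa only [centered_def, sub_add_cancel, zero_add] using
    mean_centered.add (HasMean.const (ratioDensity p c))

theorem blockSum_motzkin_eq_zero (hp2 : 2 < p) (hT : ∀ n < p, ¬ p ∣ centralTrinomial n) (n : ℕ) :
    blockSum p (fun k => if (motzkin k : ZMod p) = 0 then (1 : ℝ) else 0) n =
      {k ∈ Finset.range (p - 2) | (motzkin k : ZMod p) = 0}.card +
      (if (centralTrinomial (n + 1) : ZMod p) =
        centralTrinomial (p - 1) * centralTrinomial n then 1 else 0) +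
      (if (centralTrinomial (n + 1) : ZMod p) =
        -3 * centralTrinomial (p - 1) * centralTrinomial n then 1 else 0) := by
  have two_ne_zero : (2 : ZMod p) ≠ 0 := by
    exact_mod_cast mt (ZMod.natCast_eq_zero_iff 2 p).1 (Nat.not_dvd_of_pos_of_lt two_pos hp2)
  rw [blockSum, show Finset.range p = Finset.range (p - 2 + 1 + 1) by congr; omega,
    Finset.sum_range_succ, Finset.sum_range_succ, ← Finset.sum_boole]
  refine congrArg₂ _ (congrArg₂ _ (Finset.sum_congr rfl fun s hs => if_congr ?_ rfl rfl)
    (if_congr ?_ rfl rfl)) (if_congr ?_ rfl rfl)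
  · rw [motzkin_prime_mul_add n (by grind), mul_eq_zero,
      or_iff_right (centralTrinomial_cast_ne_zero hT n)]
  · rw [← mul_eq_zero_iff_left two_ne_zero, two_mul_motzkin_prime_mul_add_sub_two hp2.le,
      sub_eq_zero, eq_comm]
  · rw [show p - 2 + 1 = p - 1 by omega, ← mul_eq_zero_iff_left two_ne_zero,
      two_mul_motzkin_prime_mul_add_sub_one, add_comm, add_eq_zero_iff_eq_neg, neg_mul, neg_mul]

theorem valueHasDensity_motzkin_zero (hp2 : 2 < p) (hT : ∀ n < p, ¬ p ∣ centralTrinomial n) :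
    ValueHasDensity (fun n => (motzkin n : ZMod p)) 0 (motzkinZeroDensity p) := by
  rw [ValueHasDensity, hasAsympDensity_iff_hasMean ℝ]
  refine HasMean.of_blockSum (C := 1) (fun n => by split_ifs <;> simp) hp.out.pos ?_
  rw [funext (blockSum_motzkin_eq_zero hp2 hT), smul_eq_mul, RCLike.ofReal_real_eq_id, id,
    prime_mul_motzkinZeroDensity (ne_three_of_not_dvd_centralTrinomial hT)]
  exact ((HasMean.const _).add (hasMean_centralTrinomial_ratio hT _)).add
    (hasMean_centralTrinomial_ratio hT _)

end Ratios

section ZeroDensity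

variable {p : ℕ} [hp : Fact p.Prime]

theorem valueHasDensity_zero_iff_hasMean_one_character {u : ℕ → ZMod p} {d : ℝ} :
    ValueHasDensity u 0 d ↔
      HasMean (fun n => (1 : DirichletCharacter ℂ p) (u n)) ((1 - d : ℝ) : ℂ) := by
  have one_character_eq (n : ℕ) : (1 : DirichletCharacter ℂ p) (u n) =
      1 - if u n = 0 then 1 else 0 := by
    split_ifs with h
    · rw [h, MulChar.map_zero, sub_self]
    · rw [MulChar.one_apply (isUnit_iff_ne_zero.2 h), sub_zero]
  rw [ValueHasDensity, hasAsympDensity_iff_hasMean ℂ, funext one_character_eq]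
  constructor <;> intro h <;> simpa using (HasMean.const (1 : ℂ)).sub h

theorem valueHasDensity_motzkin_zero_of_dvd (h : ∃ n < p, p ∣ centralTrinomial n) :
    ValueHasDensity (fun n => (motzkin n : ZMod p)) 0 1 := by
  obtain ⟨n, hn, hdvd⟩ := h
  rw [valueHasDensity_zero_iff_hasMean_one_character, sub_self, Complex.ofReal_zero]
  refine hasMean_character_motzkin 1 ⟨n, hn, ?_⟩
  rw [(ZMod.natCast_eq_zero_iff _ _).2 hdvd, MulChar.map_zero]
  exact zero_ne_one

theorem valueHasDensity_motzkin_of_ne_zero (h : TrinomialGenerationConjectureAt p) {d : ℝ}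
    (hd : ValueHasDensity (fun n => (motzkin n : ZMod p)) 0 d) {x : ZMod p} (hx : x ≠ 0) :
    ValueHasDensity (fun n => (motzkin n : ZMod p)) x ((1 - d) / (p - 1)) := by
  have := ValueHasDensity.of_hasMean_character
    (valueHasDensity_zero_iff_hasMean_one_character.1 hd)
    (fun χ hχ => hasMean_character_motzkin χ (exists_character_centralTrinomial_ne_one h hχ))
    hx.isUnit
  rwa [Nat.totient_prime hp.out, Nat.cast_pred hp.out.pos] at this

theorem two_div_le_of_valueHasDensity_motzkin_zero (hp2 : 2 < p) {d : ℝ}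
    (hd : ValueHasDensity (fun n => (motzkin n : ZMod p)) 0 d) :
    2 / ((p : ℝ) * (p - 1)) ≤ d := by
  by_cases h : ∃ n < p, p ∣ centralTrinomial n
  · rw [tendsto_nhds_unique hd (valueHasDensity_motzkin_zero_of_dvd h)]
    have three_le : (3 : ℝ) ≤ p := by exact_mod_cast hp2
    rw [div_le_one (by nlinarith)]
    nlinarith
  · push Not at h
    rw [tendsto_nhds_unique hd (valueHasDensity_motzkin_zero hp2 h)]
    exact two_div_le_motzkinZeroDensity hp2 (ne_three_of_not_dvd_centralTrinomial h)

end ZeroDensity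

theorem mainTheorem2 (p : ℕ) (hp : p.Prime) :
    ((∃ n < p, p ∣ centralTrinomial n) →
      ValueHasDensity (fun n => (motzkin n : ZMod p)) 0 1) ∧
    (2 < p → (∀ n < p, ¬ p ∣ centralTrinomial n) →
      ValueHasDensity (fun n => (motzkin n : ZMod p)) 0 (motzkinZeroDensity p)) ∧
    (∀ D₀ : ℝ, ValueHasDensity (fun n => (motzkin n : ZMod p)) 0 D₀ →
      (TrinomialGenerationConjectureAt p → ∀ x : ZMod p, x ≠ 0 →
        ValueHasDensity (fun n => (motzkin n : ZMod p)) x ((1 - D₀) / ((p : ℝ) - 1))) ∧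
      (2 < p → 2 / ((p : ℝ) * ((p : ℝ) - 1)) ≤ D₀)) := by
  have : Fact p.Prime := ⟨hp⟩
  exact ⟨valueHasDensity_motzkin_zero_of_dvd, valueHasDensity_motzkin_zero, fun D₀ hD₀ =>
    ⟨fun generates x hx => valueHasDensity_motzkin_of_ne_zero generates hD₀ hx,
      fun two_lt => two_div_le_of_valueHasDensity_motzkin_zero two_lt hD₀⟩⟩
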